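/- Let $M$ be a finite set of items. A \emph{valuation} on $M$ is a function $v:2^M\to\mathbb{R}_{\ge 0}$ with $v(\emptyset)=0$ and $v(S)\le v(T)$ whenever $S\subseteq T$. For prices $p\in\mathbb{R}_{\ge 0}^M$, write $D_p(v)$ for the set of bundles $S\subseteq M$ that maximize the utility $v(S)-\sum_{x\in S}p_x$. The valuation $v$ is \emph{gross-substitutes} if for all prices $p,q\in\mathbb{R}_{\ge 0}^M$ with $p\le q$ pointwise and every $A\in D_p(v)$ there is $B\in D_q(v)$ with $A\cap\{x\in M: p_x=q_x\}\subseteq B$. It is \emph{unit-demand} if there are values $w_x\ge 0$ $(x\in M)$ with $v(S)=\max_{x\in S}w_x$ for every nonempty $S\subseteq M$ (and $v(\emptyset)=0$). A \emph{Walrasian equilibrium} of a valuation profile $(v_1,\dots,v_\ell)$ consists of pairwise disjoint bundles $X_1,\dots,X_\ell\subseteq M$ and prices $p\in\mathbb{R}_{\ge 0}^M$ such that $X_i\in D_p(v_i)$ for every $i$, and $p_x=0$ for every item $x$ that belongs to none of the $X_i$. \textbf{Theorem (Gul--Stacchetti maximal domain theorem).} Let $v_1$ be a valuation on $M$ that is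 not gross-substitutes. Then there exist an integer $\ell$ and unit-demand valuations $v_2,\dots,v_\ell$ on $M$ such that the profile $(v_1,v_2,\dots,v_\ell)$ has no Walrasian equilibrium. -/

import Mathlib

open scoped NNReal

/-- A valuation on the item set `M`: a monotone, normalized set function. Its values are
automatically nonnegative, since `0 = v ∅ ≤ v S`. -/
structure BundleValuation (M : Type*) where
  /-- The value of a bundle. -/
  val : Finset M → ℝ
  val_empty : val ∅ = 0
  val_mono : ∀ S T : Finset M, S ⊆ T → val S ≤ val T

namespace BundleValuation

/-- Quasi-linear utility of the bundle `S` at the prices `p`. -/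
def utility {M : Type*} (v : BundleValuation M) (p : M → ℝ) (S : Finset M) : ℝ :=
  v.val S - ∑ x ∈ S, p x

/-- The demand correspondence: the bundles that maximize utility at the prices `p`. -/
def demand {M : Type*} (v : BundleValuation M) (p : M → ℝ) : Set (Finset M) :=
  {S | ∀ T : Finset M, v.utility p T ≤ v.utility p S}

/-- Gross substitutes: whenever nonnegative prices `p` rise to `q` and `A` is demanded at `p`,
some bundle demanded at `q` contains every item of `A` whose price did not change. -/
def IsGrossSubstitutes {M : Type*} (v : BundleValuation M) : Prop :=
  ∀ p q : M → ℝ, (∀ x, 0 ≤ p x) → (∀ x, p x ≤ q x) →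
    ∀ A ∈ v.demand p, ∃ B ∈ v.demand q, ∀ x ∈ A, p x = q x → x ∈ B

/-- Unit demand: there is a nonnegative value for every item, and the value of a bundle is the
largest value of an item in it (`0` for the empty bundle, the bottom element of `ℝ≥0`). -/
def IsUnitDemand {M : Type*} (v : BundleValuation M) : Prop :=
  ∃ w : M → ℝ≥0, ∀ S : Finset M, v.val S = ((S.sup w : ℝ≥0) : ℝ)

end BundleValuation

/-- The allocation `X` and the prices `p` form a Walrasian equilibrium of the profile `v`: bundles
of different buyers are disjoint, prices are nonnegative, every buyer gets a bundle that she demands,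
and the market clears (an item that nobody gets has price zero). -/
structure IsWalrasianEquilibrium {M ι : Type*} (v : ι → BundleValuation M)
    (X : ι → Finset M) (p : M → ℝ) : Prop where
  disjoint : ∀ i j, i ≠ j → Disjoint (X i) (X j)
  price_nonneg : ∀ x, 0 ≤ p x
  mem_demand : ∀ i, X i ∈ (v i).demand p
  clearing : ∀ x, (∀ i, x ∉ X i) → p x = 0

/-- The profile `v` has a Walrasian equilibrium. -/
def AdmitsWalrasianEquilibrium {M ι : Type*} (v : ι → BundleValuation M) : Prop :=
  ∃ (X : ι → Finset M) (p : M → ℝ), IsWalrasianEquilibrium v X p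

/-! ### Demand sets and small price changes -/

namespace BundleValuation

variable {M : Type*}

/-! The obstruction is a pair of items `i`, `j` that are perfect complements at some prices `p`: the
demanded bundles contain both or neither, and both cases occur.

Such a pair exists when gross substitutes fails. Raise the prices one item at a time
(`exists_demand_add_single`); the first failure, at an item `i`, yields a price at which demanded
bundles with and without `i` tie. A generic perturbation of the prices there
(`exists_demandsJointly_of_forall`) leaves only bundles treating `i` and some `j` alike. Negative
prices produced on the way are replaced by zero (`DemandsJointly.posPart`).

Given the pair, add one rival who wants exactly one of `i` and `j`, and for every other item a rival
indifferent to buying it at its price. Half of an allocation giving the first buyer `T ∋ i, j` plus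
half of one giving her `U ∌ i, j` is a fractional equilibrium at `p`. By linear programming duality
(`IsWalrasianEquilibrium.of_half_integral`), any equilibrium allocation is supported by `p` as well.
But at `p` the first buyer takes both or neither and the rival exactly one, so one of the two items
is sold twice or left unsold at a positive price. -/

/-- At the prices `p` the items `i` and `j` are only demanded together: each demanded bundle
contains both or none of them, and both cases occur. -/
def DemandsJointly (v : BundleValuation M) (p : M → ℝ) (i j : M) : Prop :=
  i ≠ j ∧ (∀ R ∈ v.demand p, i ∈ R ↔ j ∈ R) ∧
    (∃ T ∈ v.demand p, i ∈ T) ∧ ∃ U ∈ v.demand p, i ∉ U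

theorem exists_mem_demand [Finite M] (v : BundleValuation M) (p : M → ℝ) :
    ∃ S, S ∈ v.demand p :=
  Finite.exists_max (v.utility p)

theorem utility_eq_of_mem_demand {v : BundleValuation M} {p : M → ℝ} {S T : Finset M}
    (hS : S ∈ v.demand p) (hT : T ∈ v.demand p) : v.utility p S = v.utility p T :=
  le_antisymm (hT S) (hS T)

theorem mem_demand_of_utility_le {v : BundleValuation M} {p : M → ℝ} {S T : Finset M}
    (hS : S ∈ v.demand p) (h : v.utility p S ≤ v.utility p T) : T ∈ v.demand p :=
  fun R => (hS R).trans h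

theorem utility_sub_smul (v : BundleValuation M) (p w : M → ℝ) (ε : ℝ) (S : Finset M) :
    v.utility (fun x => p x - ε * w x) S = v.utility p S + ε * ∑ x ∈ S, w x := by
  simp only [utility, Finset.sum_sub_distrib, Finset.mul_sum]
  ring

/-- Lowering the prices slightly in the direction `w` selects the demanded bundles of maximal
weight. -/
theorem exists_demand_perturb [Finite M] (v : BundleValuation M) (p w : M → ℝ) {A : Finset M}
    (hA : A ∈ v.demand p) (hmax : ∀ R ∈ v.demand p, ∑ x ∈ R, w x ≤ ∑ x ∈ A, w x) :
    ∃ q : M → ℝ, ∀ R, R ∈ v.demand q ↔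
      R ∈ v.demand p ∧ ∑ x ∈ R, w x = ∑ x ∈ A, w x := by
  -- There are finitely many bundles, so one small `ε` keeps every undemanded bundle strictly below
  -- `A`.
  have key : ∀ᶠ ε : ℝ in nhdsWithin 0 (Set.Ioi 0), ∀ R : Finset M, R ∉ v.demand p →
      v.utility p R + ε * ∑ x ∈ R, w x < v.utility p A + ε * ∑ x ∈ A, w x := by
    refine nhdsWithin_le_nhds (Filter.eventually_all.2 fun R => ?_)
    by_cases hR : R ∈ v.demand p
    · exact Filter.Eventually.of_forall fun _ h => absurd hR h
    have hlt : v.utility p R < v.utility p A := by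
      by_contra! h
      exact hR (mem_demand_of_utility_le hA h)
    have h1 : ContinuousAt (fun ε : ℝ => v.utility p R + ε * ∑ x ∈ R, w x) 0 := by fun_prop
    have h2 : ContinuousAt (fun ε : ℝ => v.utility p A + ε * ∑ x ∈ A, w x) 0 := by fun_prop
    filter_upwards [h1.eventually_lt h2 (by simpa using hlt)] with ε h _ using h
  obtain ⟨ε, hε, hpos⟩ := (key.and self_mem_nhdsWithin).exists
  have hpos : 0 < ε := hpos
  refine ⟨fun x => p x - ε * w x, fun R => ?_⟩
  have hAq : A ∈ v.demand fun x => p x - ε * w x := by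
    intro R
    rw [utility_sub_smul, utility_sub_smul]
    by_cases hR : R ∈ v.demand p
    · have := mul_le_mul_of_nonneg_left (hmax R hR) hpos.le
      linarith [hA R]
    · exact (hε R hR).le
  constructor
  · intro hR
    have hAR := hR A
    rw [utility_sub_smul, utility_sub_smul] at hAR
    have hRp : R ∈ v.demand p := by
      by_contra h
      exact absurd (hε R h) (not_lt.2 hAR)
    refine ⟨hRp, (hmax R hRp).antisymm ?_⟩
    rw [utility_eq_of_mem_demand hA hRp] at hAR
    exact le_of_mul_le_mul_left (by linarith) hpos
  · rintro ⟨hRp, hw⟩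
    refine mem_demand_of_utility_le hAq ?_
    rw [utility_sub_smul, utility_sub_smul, hw, utility_eq_of_mem_demand hA hRp]

/-! ### From a failure of gross substitutes to a jointly demanded pair -/

open Classical in
/-- The weights which single out, among the bundles between `A ∩ S` and `A ∪ S`, those that
contain `j` whenever they contain `i`. -/
noncomputable def intervalWeight (A S : Finset M) (i j x : M) : ℝ :=
  if x = i then -1 else if x = j then 1 else
    if x ∈ A ∧ x ∈ S then 2 else if x ∈ A ∨ x ∈ S then 0 else -2

open Classical in
theorem sum_intervalWeight [Fintype M] {A S : Finset M} {i j : M} (hij : i ≠ j)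
    (hi : i ∈ A \ S) (hj : j ∈ A \ S) (R : Finset M) :
    ∑ x ∈ R, intervalWeight A S i j x =
      2 * ((A ∩ S).card : ℝ) - 2 * ((A ∩ S) \ R).card - 2 * (R \ (A ∪ S)).card
        + (if j ∈ R then 1 else 0) - (if i ∈ R then 1 else 0) := by
  simp only [Finset.mem_sdiff] at hi hj
  have hcard : ∀ T : Finset M, (T.card : ℝ) = ∑ x, if x ∈ T then 1 else 0 := by
    intro T; simp
  have hR : ∑ x ∈ R, intervalWeight A S i j x
      = ∑ x, if x ∈ R then intervalWeight A S i j x else 0 := by simp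
  have hone : ∀ y : M, (if y ∈ R then (1 : ℝ) else 0)
      = ∑ x, if x = y then (if x ∈ R then 1 else 0) else 0 := by
    intro y; simp
  rw [hR, hone i, hone j, hcard, hcard, hcard, Finset.mul_sum, Finset.mul_sum, Finset.mul_sum,
    ← Finset.sum_sub_distrib, ← Finset.sum_sub_distrib, ← Finset.sum_add_distrib,
    ← Finset.sum_sub_distrib]
  refine Finset.sum_congr rfl fun x _ => ?_
  unfold intervalWeight
  by_cases hxi : x = i
  · subst hxi
    by_cases x ∈ R <;> simp_all
  by_cases hxj : x = j
  · subst hxj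
    by_cases x ∈ R <;> simp_all
  by_cases x ∈ R <;> by_cases x ∈ A <;> by_cases x ∈ S <;> simp_all

open Classical in
/-- If no demanded bundle without `i` contains the rest of a demanded bundle `A ∋ i`, then some
pair of items is demanded jointly at some prices. -/
theorem exists_demandsJointly_of_forall [Fintype M] (v : BundleValuation M) (p : M → ℝ)
    {A : Finset M} {i : M} (hA : A ∈ v.demand p) (hiA : i ∈ A)
    (hne : ∃ S ∈ v.demand p, i ∉ S)
    (hno : ∀ S ∈ v.demand p, i ∉ S → ¬ A.erase i ⊆ S) :
    ∃ q j, v.DemandsJointly q i j := by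
  -- Minimality of `A \ S` means that a demanded bundle containing `A ∩ S` but not `i` cannot
  -- contain `j` either. The weights only have to exclude bundles with `i` and without `j`.
  obtain ⟨S, ⟨hS, hiS⟩, hmin⟩ := Set.exists_min_image {S | S ∈ v.demand p ∧ i ∉ S}
    (fun S => (A \ S).card) (Set.toFinite _) hne
  obtain ⟨j, hjA, hjS⟩ := Finset.not_subset.1 (hno S hS hiS)
  obtain ⟨hji, hjA⟩ := Finset.mem_erase.1 hjA
  have hij : i ≠ j := hji.symm
  have hsum := sum_intervalWeight hij (Finset.mem_sdiff.2 ⟨hiA, hiS⟩)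
    (Finset.mem_sdiff.2 ⟨hjA, hjS⟩)
  have hwA : ∑ x ∈ A, intervalWeight A S i j x = 2 * ((A ∩ S).card : ℝ) := by
    rw [hsum, Finset.sdiff_eq_empty_iff_subset.2 Finset.inter_subset_left,
      Finset.sdiff_eq_empty_iff_subset.2 Finset.subset_union_left]
    simp [hiA, hjA]
  have hwS : ∑ x ∈ S, intervalWeight A S i j x = 2 * ((A ∩ S).card : ℝ) := by
    rw [hsum, Finset.sdiff_eq_empty_iff_subset.2 Finset.inter_subset_right,
      Finset.sdiff_eq_empty_iff_subset.2 Finset.subset_union_right]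
    simp [hiS, hjS]
  have hw : ∀ R ∈ v.demand p,
      ∑ x ∈ R, intervalWeight A S i j x < 2 * ((A ∩ S).card : ℝ) ∨
      (∑ x ∈ R, intervalWeight A S i j x = 2 * ((A ∩ S).card : ℝ) ∧ (i ∈ R ↔ j ∈ R)) := by
    intro R hR
    rw [hsum]
    by_cases h1 : A ∩ S ⊆ R
    · have hc1 : (((A ∩ S) \ R).card : ℝ) = 0 := by
        simp [Finset.sdiff_eq_empty_iff_subset.2 h1]
      have hc2 : (0 : ℝ) ≤ ((R \ (A ∪ S)).card : ℝ) := Nat.cast_nonneg _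
      by_cases hiR : i ∈ R
      · by_cases hjR : j ∈ R
        · simp only [hiR, hjR, if_true, hc1]
          rcases hc2.eq_or_lt with h | h
          · exact Or.inr ⟨by rw [← h]; ring, by simp⟩
          · exact Or.inl (by linarith)
        · simp only [hiR, hjR, if_true, if_false, hc1]
          exact Or.inl (by linarith)
      · have hjR : j ∉ R := by
          intro hjR
          have hlt : (A \ R).card < (A \ S).card := by
            refine Finset.card_lt_card ⟨fun x hx => ?_, fun h => ?_⟩
            · rw [Finset.mem_sdiff] at hx ⊢
              exact ⟨hx.1, fun hxS => hx.2 (h1 (Finset.mem_inter.2 ⟨hx.1, hxS⟩))⟩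
            · exact (Finset.mem_sdiff.1 (h (Finset.mem_sdiff.2 ⟨hjA, hjS⟩))).2 hjR
          exact absurd (hmin R ⟨hR, hiR⟩) (not_le.2 hlt)
        simp only [hiR, hjR, if_false, hc1]
        rcases hc2.eq_or_lt with h | h
        · exact Or.inr ⟨by rw [← h]; ring, by simp⟩
        · exact Or.inl (by linarith)
    -- Missing an item of `A ∩ S` costs 2, more than the 1 that `j` can bring.
    · left
      have hc1 : (1 : ℝ) ≤ (((A ∩ S) \ R).card : ℝ) := by
        exact_mod_cast Finset.card_pos.2 (Finset.sdiff_nonempty.2 h1)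
      have hc2 : (0 : ℝ) ≤ ((R \ (A ∪ S)).card : ℝ) := Nat.cast_nonneg _
      split_ifs <;> linarith
  obtain ⟨q, hq⟩ := v.exists_demand_perturb p (intervalWeight A S i j) hA fun R hR => by
    rw [hwA]
    rcases hw R hR with h | h
    exacts [h.le, h.1.le]
  refine ⟨q, j, hij, fun R hR => ?_, ⟨A, (hq A).2 ⟨hA, rfl⟩, hiA⟩,
    ⟨S, (hq S).2 ⟨hS, hwS.trans hwA.symm⟩, hiS⟩⟩
  obtain ⟨hRp, hRw⟩ := (hq R).1 hR
  rcases hw R hRp with h | h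
  · exact absurd (hRw.trans hwA) h.ne
  · exact h.2

open Classical in
theorem utility_add_single (v : BundleValuation M) (p : M → ℝ) (i : M) (t : ℝ) (S : Finset M) :
    v.utility (fun x => p x + if x = i then t else 0) S
      = v.utility p S - if i ∈ S then t else 0 := by
  simp only [utility, Finset.sum_add_distrib, Finset.sum_ite_eq']
  ring

open Classical in
/-- Gross substitutes for the rise of a single price, when no pair is demanded jointly. -/
theorem exists_demand_add_single [Fintype M] (v : BundleValuation M)
    (hv : ∀ p i j, ¬ v.DemandsJointly p i j) (p : M → ℝ) (i : M) {t : ℝ} (ht : 0 ≤ t)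
    {A : Finset M} (hA : A ∈ v.demand p) :
    ∃ B ∈ v.demand (fun x => p x + if x = i then t else 0), A.erase i ⊆ B := by
  by_cases hAq : A ∈ v.demand (fun x => p x + if x = i then t else 0)
  · exact ⟨A, hAq, Finset.erase_subset _ _⟩
  obtain ⟨S, hS⟩ := v.exists_mem_demand (fun x => p x + if x = i then t else 0)
  have hlt : v.utility (fun x => p x + if x = i then t else 0) A
      < v.utility (fun x => p x + if x = i then t else 0) S := by
    by_contra! h
    exact hAq (mem_demand_of_utility_le hS h)
  simp only [utility_add_single] at hlt
  have hAS := hA S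
  have hiA : i ∈ A := by
    by_contra hiA
    rw [if_neg hiA] at hlt
    split_ifs at hlt <;> linarith
  have hiS : i ∉ S := by
    intro hiS
    rw [if_pos hiA, if_pos hiS] at hlt
    linarith
  rw [if_pos hiA, if_neg hiS] at hlt
  -- The raise `s`, with `0 ≤ s < t`, is the one at which `A` and `S` tie.
  set s := v.utility p A - v.utility p S with hs
  have hAr : A ∈ v.demand (fun x => p x + if x = i then s else 0) := by
    intro R
    have h1 := hA R
    have h2 := hS R
    simp only [utility_add_single, if_pos hiA, if_neg hiS] at h2 ⊢
    split_ifs at h2 ⊢ <;> linarith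
  have hSr : S ∈ v.demand (fun x => p x + if x = i then s else 0) := by
    refine mem_demand_of_utility_le hAr ?_
    simp only [utility_add_single, if_pos hiA, if_neg hiS]
    linarith
  by_contra! hno
  -- Bundles without `i` have the same utility after the raises `s` and `t`, so those demanded after
  -- `s` are still demanded after `t`.
  obtain ⟨q, j, h⟩ := v.exists_demandsJointly_of_forall _ hAr hiA ⟨S, hSr, hiS⟩
    (fun R hR hiR => hno R (mem_demand_of_utility_le hS (by
      have := hR S
      simpa only [utility_add_single, if_neg hiR, if_neg hiS] using this)))
  exact hv q i j h

open Classical in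
/-- A valuation which is not gross-substitutes demands some pair of items jointly. -/
theorem exists_demandsJointly [Fintype M] (v : BundleValuation M)
    (hv : ¬ v.IsGrossSubstitutes) : ∃ p i j, v.DemandsJointly p i j := by
  by_contra! hno
  refine hv fun p q _ hpq A hA => ?_
  -- `F` is the set of items whose price has already been raised.
  have key : ∀ F : Finset M, ∃ B ∈ v.demand (fun x => if x ∈ F then q x else p x),
      ∀ x ∈ A, p x = q x → x ∈ B := by
    intro F
    induction F using Finset.induction_on with
    | empty => exact ⟨A, by simpa using hA, fun x hx _ => hx⟩
    | insert a F ha ih =>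
      obtain ⟨B, hB, hAB⟩ := ih
      by_cases hpa : p a = q a
      · refine ⟨B, ?_, hAB⟩
        convert hB using 3 with x
        by_cases hx : x = a
        · subst hx; simp [ha, hpa]
        · simp [hx]
      obtain ⟨C, hC, hBC⟩ := v.exists_demand_add_single hno _ a (sub_nonneg.2 (hpq a)) hB
      refine ⟨C, ?_, fun x hx hpx => hBC (Finset.mem_erase.2 ⟨?_, hAB x hx hpx⟩)⟩
      · convert hC using 3 with x
        by_cases hx : x = a
        · subst hx; simp [ha]
        · simp [hx]
      · rintro rfl
        exact hpa hpx
  simpa using key Finset.univ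

/-! ### Reduction to nonnegative prices -/

theorem utility_posPart_add (v : BundleValuation M) (p : M → ℝ) (S : Finset M) :
    v.utility p S = v.utility (fun x => max (p x) 0) S + ∑ x ∈ S, max (-p x) 0 := by
  have h : ∑ x ∈ S, p x = ∑ x ∈ S, max (p x) 0 - ∑ x ∈ S, max (-p x) 0 := by
    rw [← Finset.sum_sub_distrib]
    refine Finset.sum_congr rfl fun x _ => ?_
    rcases le_total (p x) 0 with hx | hx
    · rw [max_eq_right hx, max_eq_left (by linarith)]; ring
    · rw [max_eq_left hx, max_eq_right (by linarith)]; ring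
  simp only [utility, h]
  ring

open Classical in
/-- An item with a nonpositive price can be added to a demanded bundle. -/
theorem insert_mem_demand {v : BundleValuation M} {p : M → ℝ} {S : Finset M} {x : M}
    (hS : S ∈ v.demand p) (hx : p x ≤ 0) : insert x S ∈ v.demand p := by
  by_cases hxS : x ∈ S
  · rwa [Finset.insert_eq_of_mem hxS]
  refine mem_demand_of_utility_le hS ?_
  have := v.val_mono S (insert x S) (Finset.subset_insert _ _)
  simp only [utility, Finset.sum_insert hxS]
  linarith

/-- If one of the two prices were nonpositive, that item alone could be added to a demanded bundle
avoiding both. -/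
theorem DemandsJointly.pos {v : BundleValuation M} {p : M → ℝ} {i j : M}
    (h : v.DemandsJointly p i j) : 0 < p i ∧ 0 < p j := by
  classical
  obtain ⟨hij, hiff, -, U, hU, hiU⟩ := h
  have hjU : j ∉ U := fun hj => hiU ((hiff U hU).2 hj)
  constructor
  · by_contra! hi
    have := (hiff _ (insert_mem_demand hU hi)).1 (Finset.mem_insert_self _ _)
    exact (Finset.mem_insert.1 this).elim (fun e => hij e.symm) hjU
  · by_contra! hj
    have := (hiff _ (insert_mem_demand hU hj)).2 (Finset.mem_insert_self _ _)
    exact (Finset.mem_insert.1 this).elim hij hiU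

/-- Let `N` be the set of items with nonpositive price. At the truncated prices `N` is free, and at
`p` adding it collects every subsidy. So bundles demanded at `p` stay demanded, and adding `N` to a
bundle demanded at the truncated prices gives one demanded at `p`. Since `i` and `j` have positive
prices, they lie outside `N` and are unaffected. -/
theorem DemandsJointly.posPart [Fintype M] {v : BundleValuation M} {p : M → ℝ} {i j : M}
    (h : v.DemandsJointly p i j) : v.DemandsJointly (fun x => max (p x) 0) i j := by
  classical
  obtain ⟨hi, hj⟩ := h.pos
  obtain ⟨hij, hiff, ⟨T, hT, hiT⟩, U, hU, hiU⟩ := h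
  set N : Finset M := Finset.univ.filter fun x => p x ≤ 0 with hN
  have hsum : ∀ R, ∑ x ∈ R ∪ N, max (-p x) 0 = ∑ x, max (-p x) 0 := by
    intro R
    refine Finset.sum_subset (Finset.subset_univ _) fun x _ hx => ?_
    simp only [hN, Finset.mem_union, Finset.mem_filter, Finset.mem_univ, true_and, not_or,
      not_le] at hx
    exact max_eq_right (by linarith [hx.2])
  have hle : ∀ R : Finset M, ∑ x ∈ R, max (-p x) 0 ≤ ∑ x, max (-p x) 0 := fun R =>
    Finset.sum_le_sum_of_subset_of_nonneg (Finset.subset_univ _) fun _ _ _ => le_max_right _ _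
  have hadd : ∀ R : Finset M, v.utility (fun x => max (p x) 0) R
      ≤ v.utility (fun x => max (p x) 0) (R ∪ N) := by
    intro R
    have h1 := v.val_mono R (R ∪ N) Finset.subset_union_left
    have h2 : ∑ x ∈ R ∪ N, max (p x) 0 = ∑ x ∈ R, max (p x) 0 := by
      symm
      refine Finset.sum_subset Finset.subset_union_left fun x hx hxR => ?_
      have : x ∈ N := (Finset.mem_union.1 hx).resolve_left hxR
      exact max_eq_right (Finset.mem_filter.1 this).2
    simp only [utility, h2]
    linarith
  have hsub : ∀ R ∈ v.demand p, R ∈ v.demand fun x => max (p x) 0 := by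
    intro R hR Q
    have h1 := hR (Q ∪ N)
    rw [utility_posPart_add, utility_posPart_add v p R, hsum] at h1
    linarith [hadd Q, hle R]
  refine ⟨hij, fun R hR => ?_, ⟨T, hsub T hT, hiT⟩, U, hsub U hU, hiU⟩
  have hRN : R ∪ N ∈ v.demand p := by
    intro Q
    rw [utility_posPart_add, utility_posPart_add v p (R ∪ N), hsum]
    linarith [hadd R, hR Q, hle Q]
  have hiN : i ∉ N := fun hm => absurd (Finset.mem_filter.1 hm).2 (not_le.2 hi)
  have hjN : j ∉ N := fun hm => absurd (Finset.mem_filter.1 hm).2 (not_le.2 hj)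
  simpa [hiN, hjN] using hiff _ hRN

/-! ### Unit-demand valuations -/

/-- The unit-demand valuation with the item values `w`. -/
noncomputable def unitDemand (w : M → ℝ≥0) : BundleValuation M where
  val S := ((S.sup w : ℝ≥0) : ℝ)
  val_empty := by simp
  val_mono _ _ h := NNReal.coe_le_coe.2 (Finset.sup_mono h)

theorem isUnitDemand_unitDemand (w : M → ℝ≥0) : (unitDemand w).IsUnitDemand :=
  ⟨w, fun _ => rfl⟩

theorem utility_unitDemand_le {w : M → ℝ≥0} {p : M → ℝ} {c : ℝ} (hc : 0 ≤ c)
    (hp : ∀ x, 0 ≤ p x) (hw : ∀ x, (w x : ℝ) ≤ p x + c) (S : Finset M) :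
    (unitDemand w).utility p S ≤ c := by
  rcases S.eq_empty_or_nonempty with rfl | hS
  · simpa [utility, unitDemand] using hc
  · obtain ⟨y, hy, h⟩ := Finset.exists_mem_eq_sup S hS w
    have := Finset.single_le_sum (f := p) (fun x _ => hp x) hy
    simp only [utility, unitDemand, h]
    linarith [hw y]

theorem utility_unitDemand_singleton (w : M → ℝ≥0) (p : M → ℝ) (x : M) :
    (unitDemand w).utility p {x} = w x - p x := by
  simp [utility, unitDemand]

theorem utility_empty (v : BundleValuation M) (p : M → ℝ) : v.utility p ∅ = 0 := by
  simp [utility, v.val_empty]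

open Classical in
/-- An item of positive price in a demanded bundle is worth more than the other items of the
bundle. -/
theorem sup_erase_lt_of_mem_demand {w : M → ℝ≥0} {p : M → ℝ} {S : Finset M} {x : M}
    (hS : S ∈ (unitDemand w).demand p) (hx : x ∈ S) (hp : 0 < p x) :
    (S.erase x).sup w < w x := by
  by_contra! h
  have hsup : S.sup w = (S.erase x).sup w := by
    conv_lhs => rw [← Finset.insert_erase hx, Finset.sup_insert]
    exact sup_eq_right.2 h
  have h1 := hS (S.erase x)
  have h2 := Finset.add_sum_erase S p hx
  simp only [utility, unitDemand, hsup] at h1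
  linarith

end BundleValuation

/-! ### Duality for half-integral allocations -/

open BundleValuation

theorem AdmitsWalrasianEquilibrium.comp_equiv {M ι κ : Type*} {v : κ → BundleValuation M}
    (h : AdmitsWalrasianEquilibrium v) (e : ι ≃ κ) :
    AdmitsWalrasianEquilibrium fun i => v (e i) := by
  obtain ⟨X, p, h⟩ := h
  refine ⟨fun i => X (e i), p, ⟨fun i j hij => h.disjoint _ _ (e.injective.ne hij),
    h.price_nonneg, fun i => h.mem_demand _, fun x hx => h.clearing x fun k => ?_⟩⟩
  simpa using hx (e.symm k)

open Classical in
/-- If the buyers demand `T b` and `U b` at the prices `p`, and these bundles together cover each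
item exactly twice, then the allocation of any equilibrium is also supported by `p`. -/
theorem IsWalrasianEquilibrium.of_half_integral {M ι : Type*} [Fintype M] [Fintype ι]
    {v : ι → BundleValuation M} {X : ι → Finset M} {q : M → ℝ}
    (h : IsWalrasianEquilibrium v X q) {p : M → ℝ} (hp : ∀ x, 0 ≤ p x) (T U : ι → Finset M)
    (hT : ∀ b, T b ∈ (v b).demand p) (hU : ∀ b, U b ∈ (v b).demand p)
    (hTU : ∀ x, ∑ b, ((T b : Set M).indicator 1 x + (U b : Set M).indicator 1 x) = (2 : ℝ)) :
    IsWalrasianEquilibrium v X p := by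
  have hcount : ∀ r : M → ℝ, ∑ b, (∑ x ∈ T b, r x + ∑ x ∈ U b, r x) = 2 * ∑ x, r x := by
    intro r
    have h1 : ∀ b, ∑ x ∈ T b, r x + ∑ x ∈ U b, r x
        = ∑ x, ((T b : Set M).indicator 1 x + (U b : Set M).indicator 1 x) * r x := by
      intro b
      simp [add_mul, Finset.sum_add_distrib, Set.indicator_apply]
    simp_rw [h1]
    rw [Finset.sum_comm, Finset.mul_sum]
    refine Finset.sum_congr rfl fun x _ => ?_
    rw [← Finset.sum_mul, hTU]
  set Y : Finset M := Finset.univ.biUnion X with hY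
  have halloc : ∀ r : M → ℝ, ∑ b, ∑ x ∈ X b, r x = ∑ x, r x - ∑ x ∈ Yᶜ, r x := by
    intro r
    rw [← Finset.sum_biUnion fun a _ b _ hab => h.disjoint a b hab, ← hY,
      ← Finset.sum_add_sum_compl Y r]
    ring
  have hq0 : ∑ x ∈ Yᶜ, q x = 0 := Finset.sum_eq_zero fun x hx => h.clearing x fun b hb =>
    (Finset.mem_compl.1 hx) (Finset.mem_biUnion.2 ⟨b, Finset.mem_univ _, hb⟩)
  -- The prices of sold items cancel because `T` and `U` cover each item twice. At `q` the unsold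
  -- items are free and the left side is nonnegative, so the pure value difference is nonnegative.
  -- At `p` every summand on the left is nonpositive, which forces all of them, and the unsold
  -- prices, to vanish.
  have hsplit : ∀ r : M → ℝ,
      ∑ b, (2 * (v b).utility r (X b) - (v b).utility r (T b) - (v b).utility r (U b))
        = ∑ b, (2 * (v b).val (X b) - (v b).val (T b) - (v b).val (U b))
          + 2 * ∑ x ∈ Yᶜ, r x := by
    intro r
    have h1 : ∑ b, (2 * (v b).utility r (X b) - (v b).utility r (T b) - (v b).utility r (U b))
        = ∑ b, (2 * (v b).val (X b) - (v b).val (T b) - (v b).val (U b))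
          - 2 * ∑ b, ∑ x ∈ X b, r x + ∑ b, (∑ x ∈ T b, r x + ∑ x ∈ U b, r x) := by
      rw [Finset.mul_sum, ← Finset.sum_sub_distrib, ← Finset.sum_add_distrib]
      refine Finset.sum_congr rfl fun b _ => ?_
      simp only [utility]
      ring
    rw [h1, hcount, halloc]
    ring
  have hqnn : 0 ≤ ∑ b, (2 * (v b).utility q (X b) - (v b).utility q (T b)
      - (v b).utility q (U b)) := Finset.sum_nonneg fun b _ => by
    linarith [h.mem_demand b (T b), h.mem_demand b (U b)]
  rw [hsplit, hq0] at hqnn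
  have hterm : ∀ b ∈ Finset.univ, 2 * (v b).utility p (X b) - (v b).utility p (T b)
      - (v b).utility p (U b) ≤ 0 := fun b _ => by
    linarith [hT b (X b), hU b (X b)]
  have hpY : 0 ≤ ∑ x ∈ Yᶜ, p x := Finset.sum_nonneg fun x _ => hp x
  have hps := Finset.sum_nonpos hterm
  have hsp := hsplit p
  have hsum0 : ∑ b, (2 * (v b).utility p (X b) - (v b).utility p (T b)
      - (v b).utility p (U b)) = 0 := by linarith
  have hY0 : ∑ x ∈ Yᶜ, p x = 0 := by linarith
  refine ⟨h.disjoint, hp, fun b => mem_demand_of_utility_le (hT b) ?_, fun x hx => ?_⟩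
  · have h0 := (Finset.sum_eq_zero_iff_of_nonpos hterm).1 hsum0 b (Finset.mem_univ _)
    linarith [utility_eq_of_mem_demand (hT b) (hU b)]
  · refine (Finset.sum_eq_zero_iff_of_nonneg fun x _ => hp x).1 hY0 x ?_
    simpa [hY] using hx

/-! ### The market without equilibrium -/

namespace BundleValuation

variable {M : Type*}

open Classical in
/-- Item values of the buyers that compete with a buyer who demands `i` and `j` jointly at the
prices `p`: the buyer `none` gains one unit from either of `i` and `j`, and the buyer `some x` is
indifferent between `x` and nothing. -/
noncomputable def rivalValue (p : M → ℝ) (i j : M) : Option M → M → ℝ≥0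
  | none => fun y => if y = i ∨ y = j then (p y + 1).toNNReal else 0
  | some x => fun y => if y = x ∧ y ≠ i ∧ y ≠ j then (p y).toNNReal else 0

open Classical in
theorem DemandsJointly.not_admitsWalrasianEquilibrium [Fintype M] {v : BundleValuation M}
    {p : M → ℝ} {i j : M} (h : v.DemandsJointly p i j) (hp : ∀ x, 0 ≤ p x) :
    ¬ AdmitsWalrasianEquilibrium fun o : Option (Option M) =>
      o.elim v fun b => unitDemand (rivalValue p i j b) := by
  rintro ⟨X, q, hX⟩
  obtain ⟨hpi, hpj⟩ := h.pos
  obtain ⟨hij, hiff, ⟨T, hT, hiT⟩, U, hU, hiU⟩ := h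
  have hjT : j ∈ T := (hiff T hT).1 hiT
  have hjU : j ∉ U := fun hj => hiU ((hiff U hU).2 hj)
  have hnone : ∀ y, y = i ∨ y = j → (rivalValue p i j none y : ℝ) = p y + 1 := by
    intro y hy
    simp [rivalValue, hy, add_nonneg (hp y) zero_le_one]
  have hnone0 : ∀ y, ¬ (y = i ∨ y = j) → rivalValue p i j none y = 0 := by
    intro y hy
    simp only [rivalValue, if_neg hy]
  have hdnone : ∀ y, y = i ∨ y = j → {y} ∈ (unitDemand (rivalValue p i j none)).demand p := by
    intro y hy S
    rw [utility_unitDemand_singleton, hnone y hy]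
    refine (utility_unitDemand_le zero_le_one hp (fun x => ?_) S).trans (by linarith)
    by_cases hx : x = i ∨ x = j
    · exact (hnone x hx).le
    · rw [hnone0 x hx]
      simpa using add_nonneg (hp x) zero_le_one
  have hsome : ∀ x S, (unitDemand (rivalValue p i j (some x))).utility p S ≤ 0 := by
    intro x S
    refine utility_unitDemand_le le_rfl hp (fun y => ?_) S
    simp only [rivalValue]
    split_ifs <;> simp [hp y]
  have hdempty : ∀ x, ∅ ∈ (unitDemand (rivalValue p i j (some x))).demand p := by
    intro x S
    rw [utility_empty]
    exact hsome x S
  have hdsome : ∀ x, x ≠ i → x ≠ j →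
      {x} ∈ (unitDemand (rivalValue p i j (some x))).demand p := by
    intro x hxi hxj S
    have hx : (rivalValue p i j (some x) x : ℝ) = p x := by simp [rivalValue, hxi, hxj, hp x]
    rw [utility_unitDemand_singleton, hx, sub_self]
    exact hsome x S
  have hrest : ∀ (R : Finset M) (x : M),
      (if x ∈ R ∨ x = i ∨ x = j then (∅ : Finset M) else {x})
        ∈ (unitDemand (rivalValue p i j (some x))).demand p := by
    intro R x
    split_ifs with hx
    · exact hdempty x
    · push Not at hx
      exact hdsome x hx.2.1 hx.2.2
  -- Pair `T` with `{i}` and `U` with `{j}`; the other rivals pick up what remains. Both `i` and `j`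
  -- are then covered twice by the first allocation and the second together: once through `T`, once
  -- through a singleton.
  have hXp : IsWalrasianEquilibrium _ X p := hX.of_half_integral hp
    (fun o => o.elim T fun b => b.elim {i} fun x => if x ∈ T ∨ x = i ∨ x = j then ∅ else {x})
    (fun o => o.elim U fun b => b.elim {j} fun x => if x ∈ U ∨ x = i ∨ x = j then ∅ else {x})
    (by
      rintro (_ | _ | x)
      exacts [hT, hdnone i (Or.inl rfl), hrest T x])
    (by
      rintro (_ | _ | x)
      exacts [hU, hdnone j (Or.inr rfl), hrest U x])
    (by
      intro y
      have hcount : ∀ R : Finset M, ∑ x,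
          ((if x ∈ R ∨ x = i ∨ x = j then (∅ : Finset M) else {x} : Finset M) : Set M).indicator
            (1 : M → ℝ) y = if y ∈ R ∨ y = i ∨ y = j then 0 else 1 := by
        intro R
        rw [Finset.sum_eq_single y]
        · by_cases hy : y ∈ R ∨ y = i ∨ y = j <;> simp [hy]
        · intro x _ hxy
          by_cases hx : x ∈ R ∨ x = i ∨ x = j <;> simp [hx, hxy.symm]
        · simp
      simp only [Fintype.sum_option, Option.elim_none, Option.elim_some, Finset.sum_add_distrib,
        hcount]
      simp only [Set.indicator_apply, Finset.mem_coe, Finset.mem_singleton, Pi.one_apply]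
      by_cases hyi : y = i
      · subst hyi
        norm_num [hiT, hiU, hij]
      by_cases hyj : y = j
      · subst hyj
        norm_num [hjT, hjU, hyi]
      by_cases y ∈ T <;> by_cases y ∈ U <;> norm_num [*])
  have hv : X none ∈ v.demand p := hXp.mem_demand none
  have hA : X (some none) ∈ (unitDemand (rivalValue p i j none)).demand p :=
    hXp.mem_demand (some none)
  have hB : ∀ x, X (some (some x)) ∈ (unitDemand (rivalValue p i j (some x))).demand p :=
    fun x => hXp.mem_demand (some (some x))
  have hBi : ∀ x y, y = i ∨ y = j → y ∉ X (some (some x)) := by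
    intro x y hy hyX
    have hpy : 0 < p y := by rcases hy with rfl | rfl <;> assumption
    have hlt := sup_erase_lt_of_mem_demand (hB x) hyX hpy
    have h0 : rivalValue p i j (some x) y = 0 := by
      simp only [rivalValue]
      exact if_neg fun hh => hy.elim hh.2.1 hh.2.2
    rw [h0] at hlt
    exact not_lt_bot hlt
  -- The extra unit in `rivalValue` makes buying `i` strictly better than any bundle without `i` and
  -- `j`.
  have hAone : i ∈ X (some none) ∨ j ∈ X (some none) := by
    by_contra! hno
    have h1 := hA {i}
    rw [utility_unitDemand_singleton, hnone i (Or.inl rfl)] at h1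
    have hsup : (X (some none)).sup (rivalValue p i j none) = 0 := by
      refine le_antisymm (Finset.sup_le fun y hy => (hnone0 y ?_).le) bot_le
      rintro (rfl | rfl)
      exacts [hno.1 hy, hno.2 hy]
    have h2 := Finset.sum_nonneg fun x (_ : x ∈ X (some none)) => hp x
    simp only [utility, unitDemand, hsup, NNReal.coe_zero] at h1
    linarith
  -- Holding both would require each of the two items to be worth strictly more than the other.
  have hAnot : ¬ (i ∈ X (some none) ∧ j ∈ X (some none)) := by
    rintro ⟨hi, hj⟩
    have h1 := (Finset.le_sup (f := rivalValue p i j none)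
      (Finset.mem_erase.2 ⟨hij.symm, hj⟩)).trans_lt (sup_erase_lt_of_mem_demand hA hi hpi)
    have h2 := (Finset.le_sup (f := rivalValue p i j none)
      (Finset.mem_erase.2 ⟨hij, hi⟩)).trans_lt (sup_erase_lt_of_mem_demand hA hj hpj)
    exact lt_asymm h1 h2
  have hdisj : ∀ y, y ∈ X none → y ∉ X (some none) := fun y h1 h2 =>
    Finset.disjoint_left.1 (hXp.disjoint none (some none) (by simp)) h1 h2
  by_cases hi : i ∈ X none
  · exact hAone.elim (hdisj i hi) (hdisj j ((hiff _ hv).1 hi))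
  have hj : j ∉ X none := fun hj => hi ((hiff _ hv).2 hj)
  have hunsold : ∀ y, y = i ∨ y = j → y ∉ X none → y ∉ X (some none) → p y = 0 := by
    intro y hy h1 h2
    refine hXp.clearing y ?_
    rintro (_ | _ | x)
    exacts [h1, h2, hBi x y hy]
  by_cases hiA : i ∈ X (some none)
  · exact hpj.ne' (hunsold j (Or.inr rfl) hj fun hjA => hAnot ⟨hiA, hjA⟩)
  · exact hpi.ne' (hunsold i (Or.inl rfl) hi hiA)

end BundleValuation

theorem theorem1 {M : Type*} [Fintype M] (v₁ : BundleValuation M)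
    (hv₁ : ¬ v₁.IsGrossSubstitutes) :
    ∃ (k : ℕ) (w : Fin k → BundleValuation M),
      (∀ i, (w i).IsUnitDemand) ∧
      ¬ AdmitsWalrasianEquilibrium (Fin.cons v₁ w : Fin (k + 1) → BundleValuation M) := by
  obtain ⟨p, i, j, h⟩ := v₁.exists_demandsJointly hv₁
  let e := Fintype.equivFin (Option M)
  refine ⟨Fintype.card (Option M),
    fun n => unitDemand (rivalValue (fun x => max (p x) 0) i j (e.symm n)),
    fun _ => isUnitDemand_unitDemand _, fun hW => ?_⟩
  refine h.posPart.not_admitsWalrasianEquilibrium (fun _ => le_max_right _ _) ?_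
  convert hW.comp_equiv ((Equiv.optionCongr e).trans (finSuccEquiv _).symm) using 1
  funext o
  rcases o with _ | b <;> simp
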